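/- Let $n\ge 1$, let $\mathbb B^n=\{z\in\mathbb C^n:|z|<1\}$ and let $\alpha>-1$. For $a,z\in\mathbb C^n$ write $z\bar a=\sum_j z_j\bar a_j$. Let $dm$ be normalized Lebesgue measure on $\mathbb B^n$, and let $B^1_\alpha$ be the space of holomorphic functions $f$ on $\mathbb B^n$ with $\int_{\mathbb B^n}(1-|z|^2)^{\alpha}|f(z)|\,dm(z)<\infty$. For $a,b\in\mathbb B^n$ let $d(a,b)=|\varphi_a(b)|$, where $\varphi_a$ is the involutive automorphism of $\mathbb B^n$ exchanging $0$ and $a$, $$\varphi_a(z)=\frac{a-P_az-(1-|a|^2)^{1/2}(z-P_az)}{1-z\bar a},$$ with $P_a$ the orthogonal projection of $\mathbb C^n$ onto $\mathbb Ca$ ($P_0=0$). A (finite or infinite) sequence $\{a_k\}_k\subset\mathbb B^n$ is called separated if there is $\delta>0$ such that $d(a_j,a_k)\ge\delta$ for all $j\ne k$. It is called $B^1_\alpha$-interpolating if for every sequence $\{v_k\}_k$ of complex numbers with $\sum_k(1-|a_k|^2)^{n+1+\alpha}|v_k|<\infty$ there exists $f\in B^1_\alpha$ such that $f(a_k)=v_k$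 for all $k$. **Corollary 4.4.** A (finite or infinite) sequence $\{a_k\}_k$ in $\mathbb B^n$ is the union of a finite number of separated sequences if and only if it is the union of a finite number of $B^1_\alpha$-interpolating sequences. Here $\{a_k\}_{k\in I}$ is the union of finitely many sequences with a given property if $I=S_1\cup\dots\cup S_N$ for some $N$ and some sets $S_i\subset I$ such that each of the subsequences $\{a_k\}_{k\in S_i}$ (possibly finite or empty) has that property. -/

import Mathlib

open MeasureTheory Metric
open scoped ENNReal

noncomputable section

namespace BallInterpolation

universe u

/-- The space `ℂⁿ` with its Hermitian norm; its open unit ball is `ball 0 1`. -/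
abbrev Cn (n : ℕ) : Type := EuclideanSpace ℂ (Fin n)

/-- The involutive automorphism `φ_a` of the unit ball exchanging `0` and `a`:
`φ_a(z) = (a - P_a z - (1 - |a|²)^{1/2} Q_a z) / (1 - ⟨z, a⟩)`, where `P_a` is the orthogonal
projection onto the complex line spanned by `a` (`P_0 = 0`) and `Q_a = I - P_a`.
Here `inner ℂ a z` is `∑ j, z_j * conj a_j`. -/
def ballInvolution {n : ℕ} (a z : Cn n) : Cn n :=
  let P : Cn n := (inner ℂ a z / inner ℂ a a : ℂ) • a
  (1 - inner ℂ a z : ℂ)⁻¹ • (a - P - Real.sqrt (1 - ‖a‖ ^ 2) • (z - P))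

/-- The invariant distance `d(a, b) = |φ_a(b)|` on the unit ball. -/
def invDist {n : ℕ} (a b : Cn n) : ℝ := ‖ballInvolution a b‖

/-- A family of points of the ball is separated if `d(a_j, a_k) ≥ δ` for all `j ≠ k`
and some `δ > 0`. -/
def IsSeparatedSeq {n : ℕ} {κ : Type u} (a : κ → Cn n) : Prop :=
  ∃ δ : ℝ, 0 < δ ∧ ∀ j k, j ≠ k → δ ≤ invDist (a j) (a k)

/-- Normalized Lebesgue measure on the unit ball of `ℂⁿ`. -/
def ballMeasure (n : ℕ) : Measure (Cn n) :=
  (volume (ball (0 : Cn n) 1))⁻¹ • volume.restrict (ball (0 : Cn n) 1)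

/-- Membership in the weighted Bergman space `B_α^p` (`0 < p ≤ ∞`, `α > -1/p`): `f` is
holomorphic in the unit ball and `(1 - |z|²)^α f(z)` belongs to `L^p` of the ball. -/
def MemBergman (n : ℕ) (p : ℝ≥0∞) (α : ℝ) (f : Cn n → ℂ) : Prop :=
  DifferentiableOn ℂ f (ball 0 1) ∧
    MemLp (fun z => (1 - ‖z‖ ^ 2) ^ α • f z) p (ballMeasure n)

/-- Membership in `ℓ_β^p(a)`: the family `(1 - |a_k|²)^β v_k` belongs to `ℓ^p`. -/
def MemWeightedLp {n : ℕ} {κ : Type u} (p : ℝ≥0∞) (β : ℝ) (a : κ → Cn n) (v : κ → ℂ) : Prop :=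
  Memℓp (fun k => (1 - ‖a k‖ ^ 2) ^ β • v k) p

/-- A family `a` of points of the ball is `B_α^p`-interpolating if every
`v ∈ ℓ^p_{(n+1)/p + α}(a)` is the family of values at the points `a_k` of some `f ∈ B_α^p`.
For `p = ∞` the number `(n+1)/p` is `0`, in accordance with `∞.toReal = 0` and `x / 0 = 0`. -/
def IsInterpolatingSeq {n : ℕ} {κ : Type u} (p : ℝ≥0∞) (α : ℝ) (a : κ → Cn n) : Prop :=
  ∀ v : κ → ℂ, MemWeightedLp p (((n : ℝ) + 1) / p.toReal + α) a v →
    ∃ f : Cn n → ℂ, MemBergman n p α f ∧ ∀ k, f (a k) = v k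

/-- The family `a` is the union of finitely many subfamilies having the property `P`. The
subfamilies are given by sets of indices, so repeated points are counted with multiplicity;
they may be finite or empty. -/
def IsFiniteUnionOf {n : ℕ} {ι : Type u} (P : ∀ {κ : Type u}, (κ → Cn n) → Prop)
    (a : ι → Cn n) : Prop :=
  ∃ (N : ℕ) (S : Fin N → Set ι), (⋃ i, S i) = Set.univ ∧ ∀ i, P (fun k : S i => a k)

end BallInterpolation

end

namespace BallInterpolation

/-! Put t = n + 1 + α and k_a(z) = (1 - |a|²)^t (1 - z ā)^(-2t). Weighted composition f ↦ k_a · (f ∘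
φ_a) preserves the norm of B¹_α (`bergmanNorm_pullback`), so local estimates at 0 move to any point
of the ball. An interpolating sequence is already separated (`IsInterpolatingSeq.isSeparatedSeq`): a
function of norm at most B varies by O(B|u|) near 0, and Banach–Steinhaus makes the resulting
estimates uniform over all ℓ¹ data. The same decomposition therefore serves for this implication.
Conversely, a volume packing argument bounds the sums of (1 - d(a_j, a_k)²)^t over j by a constant C
independent of k, even for a finite union of separated sequences
(`exists_sum_le_of_isFiniteUnionOf_isSeparatedSeq`). Colouring the indices with M > 2C colours
brings the off-diagonal sums within each colour below 1/2 (`exists_coloring_sum_le`). In a colour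
class the weighted matrix of values k_{a_k}(a_j) is the identity plus an operator of norm at most
1/2 on ℓ¹, hence invertible, and a series of kernels interpolates (`isInterpolatingSeq_of_sum_le`).
-/

variable {n : ℕ}

/-! ### The involutions and the invariant distance. -/

theorem one_sub_inner_re_pos {a z : Cn n} (ha : ‖a‖ < 1) (hz : ‖z‖ < 1) :
    0 < (1 - inner ℂ a z : ℂ).re := by
  have h1 : (inner ℂ a z : ℂ).re ≤ ‖a‖ * ‖z‖ :=
    (Complex.re_le_norm _).trans (norm_inner_le_norm a z)
  have h2 : ‖a‖ * ‖z‖ < 1 := by nlinarith [norm_nonneg a, norm_nonneg z]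
  simp only [Complex.sub_re, Complex.one_re]
  linarith

theorem one_sub_inner_ne_zero {a z : Cn n} (ha : ‖a‖ < 1) (hz : ‖z‖ < 1) :
    (1 - inner ℂ a z : ℂ) ≠ 0 := fun h => by
  have := one_sub_inner_re_pos ha hz
  simp [h] at this

theorem one_sub_inner_norm_pos {a z : Cn n} (ha : ‖a‖ < 1) (hz : ‖z‖ < 1) :
    0 < ‖(1 - inner ℂ a z : ℂ)‖ := norm_pos_iff.2 (one_sub_inner_ne_zero ha hz)

theorem one_sub_inner_norm_le {a z : Cn n} (ha : ‖a‖ < 1) (hz : ‖z‖ < 1) :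
    ‖(1 - inner ℂ a z : ℂ)‖ ≤ 2 := by
  have h1 := norm_inner_le_norm (𝕜 := ℂ) a z
  have h2 : ‖a‖ * ‖z‖ < 1 := by nlinarith [norm_nonneg a, norm_nonneg z]
  calc ‖(1 - inner ℂ a z : ℂ)‖ ≤ ‖(1 : ℂ)‖ + ‖(inner ℂ a z : ℂ)‖ := norm_sub_le _ _
    _ ≤ 2 := by rw [norm_one]; linarith

theorem norm_one_sub_inner_comm (a z : Cn n) :
    ‖(1 - inner ℂ a z : ℂ)‖ = ‖(1 - inner ℂ z a : ℂ)‖ := by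
  rw [← inner_conj_symm a z, ← Complex.norm_conj]
  simp

theorem one_sub_sq_norm_pos {a : Cn n} (ha : ‖a‖ < 1) : 0 < 1 - ‖a‖ ^ 2 := by
  nlinarith [norm_nonneg a]

theorem sqrt_pos {a : Cn n} (ha : ‖a‖ < 1) : 0 < Real.sqrt (1 - ‖a‖ ^ 2) :=
  Real.sqrt_pos.2 (one_sub_sq_norm_pos ha)

theorem inner_self_eq_ofReal (a : Cn n) : (inner ℂ a a : ℂ) = ((‖a‖ ^ 2 : ℝ) : ℂ) := by
  rw [inner_self_eq_norm_sq_to_K]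
  simp

theorem ofReal_sqrt_sq {a : Cn n} (ha : ‖a‖ < 1) :
    ((Real.sqrt (1 - ‖a‖ ^ 2) : ℝ) : ℂ) ^ 2 = 1 - inner ℂ a a := by
  rw [← Complex.ofReal_pow, Real.sq_sqrt (one_sub_sq_norm_pos ha).le,
    inner_self_eq_norm_sq_to_K]
  simp

theorem one_add_sqrt_ne_zero {a : Cn n} (ha : ‖a‖ < 1) :
    (1 + (Real.sqrt (1 - ‖a‖ ^ 2) : ℝ) : ℂ) ≠ 0 := by
  have : (0 : ℝ) < 1 + Real.sqrt (1 - ‖a‖ ^ 2) := by have := sqrt_pos ha; linarith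
  exact_mod_cast this.ne'

/-- A formula for the involution that has no singularity at `a = 0`. -/
theorem ballInvolution_eq {a : Cn n} (ha : ‖a‖ < 1) (z : Cn n) :
    ballInvolution a z = (1 - inner ℂ a z : ℂ)⁻¹ •
      (a - ((Real.sqrt (1 - ‖a‖ ^ 2) : ℝ) : ℂ) • z -
        (inner ℂ a z / (1 + (Real.sqrt (1 - ‖a‖ ^ 2) : ℝ)) : ℂ) • a) := by
  have hs := ofReal_sqrt_sq ha
  have h1 := one_add_sqrt_ne_zero ha
  simp only [ballInvolution]
  rw [← Complex.coe_smul (Real.sqrt (1 - ‖a‖ ^ 2))]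
  set s : ℂ := ((Real.sqrt (1 - ‖a‖ ^ 2) : ℝ) : ℂ)
  congr 1
  by_cases h0 : a = 0
  · simp [h0]
  have haa : (inner ℂ a a : ℂ) ≠ 0 := inner_self_ne_zero.2 h0
  have key : (inner ℂ a z / (1 + s) : ℂ) = inner ℂ a z / inner ℂ a a * (1 - s) := by
    field_simp
    linear_combination (inner ℂ a z) * hs
  rw [key]
  module

/-- This polarised identity is the source of the metric facts below: w = z gives the formula for 1 -
|φ_a(z)|², z = 0 gives the inner product with a, and its modulus gives the invariance of d. -/
theorem one_sub_inner_ballInvolution {a z w : Cn n} (ha : ‖a‖ < 1) (hz : ‖z‖ < 1)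
    (hw : ‖w‖ < 1) :
    (1 - inner ℂ (ballInvolution a z) (ballInvolution a w) : ℂ) =
      (1 - inner ℂ a a) * (1 - inner ℂ z w) / ((1 - inner ℂ z a) * (1 - inner ℂ a w)) := by
  have hs := ofReal_sqrt_sq ha
  have h1 := one_add_sqrt_ne_zero ha
  have h2 := one_sub_inner_ne_zero hz ha
  have h3 := one_sub_inner_ne_zero ha hw
  rw [ballInvolution_eq ha, ballInvolution_eq ha]
  simp only [inner_smul_left, inner_smul_right, inner_sub_left, inner_sub_right, map_inv₀,
    map_sub, map_one, inner_conj_symm, map_div₀, map_add, Complex.conj_ofReal]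
  set s : ℂ := ((Real.sqrt (1 - ‖a‖ ^ 2) : ℝ) : ℂ)
  have haa : (inner ℂ a a : ℂ) = 1 - s ^ 2 := by rw [hs]; ring
  rw [haa]
  generalize (inner ℂ a w : ℂ) = p at *
  generalize (inner ℂ z a : ℂ) = q at *
  generalize (inner ℂ z w : ℂ) = r at *
  field_simp
  ring

theorem ballInvolution_zero {a : Cn n} (ha : ‖a‖ < 1) : ballInvolution a 0 = a := by
  simp [ballInvolution_eq ha]

theorem one_sub_inner_ballInvolution_right {a z : Cn n} (ha : ‖a‖ < 1) (hz : ‖z‖ < 1) :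
    (1 - inner ℂ a (ballInvolution a z) : ℂ) = (1 - inner ℂ a a) / (1 - inner ℂ a z) := by
  have := one_sub_inner_ballInvolution ha (z := 0) (w := z) (by simp) hz
  rw [ballInvolution_zero ha] at this
  simpa using this

theorem one_sub_norm_sq_ballInvolution {a z : Cn n} (ha : ‖a‖ < 1) (hz : ‖z‖ < 1) :
    1 - ‖ballInvolution a z‖ ^ 2 =
      (1 - ‖a‖ ^ 2) * (1 - ‖z‖ ^ 2) / ‖(1 - inner ℂ a z : ℂ)‖ ^ 2 := by
  have h := one_sub_inner_ballInvolution ha hz hz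
  have h2 : (1 - inner ℂ z a : ℂ) * (1 - inner ℂ a z) =
      ((‖(1 - inner ℂ a z : ℂ)‖ ^ 2 : ℝ) : ℂ) := by
    rw [← inner_conj_symm z a]
    have := Complex.conj_mul' (1 - inner ℂ a z : ℂ)
    simp only [map_sub, map_one] at this
    rw [this]; push_cast; rfl
  rw [h2] at h
  simp only [inner_self_eq_ofReal] at h
  exact_mod_cast h

theorem norm_ballInvolution_lt {a z : Cn n} (ha : ‖a‖ < 1) (hz : ‖z‖ < 1) :
    ‖ballInvolution a z‖ < 1 := by
  have h := one_sub_norm_sq_ballInvolution ha hz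
  have : 0 < 1 - ‖ballInvolution a z‖ ^ 2 := by
    rw [h]
    have h1 := one_sub_sq_norm_pos ha
    have h2 := one_sub_sq_norm_pos hz
    have h3 := one_sub_inner_norm_pos ha hz
    positivity
  nlinarith [norm_nonneg (ballInvolution a z)]

theorem ballInvolution_ballInvolution {a z : Cn n} (ha : ‖a‖ < 1) (hz : ‖z‖ < 1) :
    ballInvolution a (ballInvolution a z) = z := by
  have hs := ofReal_sqrt_sq ha
  have h1 := one_add_sqrt_ne_zero ha
  have h3 := one_sub_inner_ne_zero ha hz
  have h4 := one_sub_inner_ballInvolution_right ha hz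
  have h0 : ((Real.sqrt (1 - ‖a‖ ^ 2) : ℝ) : ℂ) ≠ 0 := by exact_mod_cast (sqrt_pos ha).ne'
  have h5 : (inner ℂ a (ballInvolution a z) : ℂ) = 1 - (1 - inner ℂ a a) / (1 - inner ℂ a z) := by
    rw [← h4]; ring
  rw [ballInvolution_eq ha (ballInvolution a z), h4, h5, ← hs, ballInvolution_eq ha z]
  set s : ℂ := ((Real.sqrt (1 - ‖a‖ ^ 2) : ℝ) : ℂ)
  generalize (inner ℂ a z : ℂ) = p at *
  match_scalars
  · field_simp
    ring
  · field_simp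

theorem invDist_nonneg (a b : Cn n) : 0 ≤ invDist a b := norm_nonneg _

theorem one_sub_invDist_sq {a b : Cn n} (ha : ‖a‖ < 1) (hb : ‖b‖ < 1) :
    1 - invDist a b ^ 2 = (1 - ‖a‖ ^ 2) * (1 - ‖b‖ ^ 2) / ‖(1 - inner ℂ a b : ℂ)‖ ^ 2 :=
  one_sub_norm_sq_ballInvolution ha hb

/-- In the formula for 1 - d², the factors that φ_a produces in the numerator and in the denominator
cancel. -/
theorem invDist_ballInvolution {a z w : Cn n} (ha : ‖a‖ < 1) (hz : ‖z‖ < 1) (hw : ‖w‖ < 1) :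
    invDist (ballInvolution a z) (ballInvolution a w) = invDist z w := by
  have h := one_sub_invDist_sq (norm_ballInvolution_lt ha hz) (norm_ballInvolution_lt ha hw)
  rw [one_sub_norm_sq_ballInvolution ha hz, one_sub_norm_sq_ballInvolution ha hw,
    one_sub_inner_ballInvolution ha hz hw] at h
  have h' := one_sub_invDist_sq hz hw
  have hA : ‖(1 - inner ℂ a a : ℂ)‖ = 1 - ‖a‖ ^ 2 := by
    rw [inner_self_eq_norm_sq_to_K]
    have := Complex.norm_of_nonneg (one_sub_sq_norm_pos ha).le
    push_cast at this
    exact this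
  rw [norm_div, norm_mul, norm_mul, hA, norm_one_sub_inner_comm z a] at h
  have p1 := one_sub_inner_norm_pos ha hz
  have p2 := one_sub_inner_norm_pos ha hw
  have p3 := one_sub_inner_norm_pos hz hw
  have p4 := one_sub_sq_norm_pos ha
  have : 1 - invDist (ballInvolution a z) (ballInvolution a w) ^ 2 = 1 - invDist z w ^ 2 := by
    rw [h, h']
    field_simp
  exact (pow_left_inj₀ (invDist_nonneg _ _) (invDist_nonneg _ _) two_ne_zero).1 (by linarith)

theorem invDist_comm {a b : Cn n} (ha : ‖a‖ < 1) (hb : ‖b‖ < 1) : invDist a b = invDist b a := by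
  have h := one_sub_invDist_sq ha hb
  have h' := one_sub_invDist_sq hb ha
  rw [norm_one_sub_inner_comm, mul_comm] at h
  exact (pow_left_inj₀ (invDist_nonneg _ _) (invDist_nonneg _ _) two_ne_zero).1 (by linarith)

/-- Two points close to a third one for the invariant distance are close to each other. -/
theorem invDist_le_of_invDist_le {w a b : Cn n} {r : ℝ} (hr : r < 1) (hw : ‖w‖ < 1)
    (ha : ‖a‖ < 1) (hb : ‖b‖ < 1) (h1 : invDist w a ≤ r) (h2 : invDist w b ≤ r) :
    invDist a b ≤ 2 * r := by
  -- By invariance w may be moved to 0; the two points then have Euclidean norm at most r.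
  rw [← invDist_ballInvolution hw ha hb]
  change ‖ballInvolution w a‖ ≤ r at h1
  change ‖ballInvolution w b‖ ≤ r at h2
  have hx := norm_ballInvolution_lt hw ha
  have hy := norm_ballInvolution_lt hw hb
  generalize ballInvolution w a = x at *
  generalize ballInvolution w b = y at *
  have h := one_sub_invDist_sq hx hy
  have hr0 : 0 ≤ r := (norm_nonneg _).trans h1
  have hin : ‖(1 - inner ℂ x y : ℂ)‖ ≤ 1 + r ^ 2 := by
    have e1 := norm_inner_le_norm (𝕜 := ℂ) x y
    calc ‖(1 - inner ℂ x y : ℂ)‖ ≤ ‖(1 : ℂ)‖ + ‖(inner ℂ x y : ℂ)‖ := norm_sub_le _ _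
      _ ≤ 1 + r ^ 2 := by rw [norm_one]; nlinarith [norm_nonneg x, norm_nonneg y]
  have hpos := one_sub_inner_norm_pos hx hy
  have hge : (1 - r ^ 2) ^ 2 / (1 + r ^ 2) ^ 2 ≤ 1 - invDist x y ^ 2 := by
    rw [h]
    have e1 : 1 - r ^ 2 ≤ 1 - ‖x‖ ^ 2 := by nlinarith [norm_nonneg x]
    have e2 : 1 - r ^ 2 ≤ 1 - ‖y‖ ^ 2 := by nlinarith [norm_nonneg y]
    have e3 : 0 ≤ 1 - r ^ 2 := by nlinarith
    have e4 : (1 - r ^ 2) ^ 2 ≤ (1 - ‖x‖ ^ 2) * (1 - ‖y‖ ^ 2) := by nlinarith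
    have e5 := (sq_nonneg _).trans e4
    gcongr
  rw [div_le_iff₀ (by positivity)] at hge
  have hd := invDist_nonneg x y
  have hsq : invDist x y ^ 2 ≤ (2 * r) ^ 2 := by
    -- This rests on (1 + r²)² - (1 - r²)² = (2r)².
    have : invDist x y ^ 2 * (1 + r ^ 2) ^ 2 ≤ (2 * r) ^ 2 := by nlinarith
    have h4 : (1 : ℝ) ≤ (1 + r ^ 2) ^ 2 := by nlinarith [sq_nonneg r]
    nlinarith [sq_nonneg (invDist x y)]
  exact (pow_le_pow_iff_left₀ hd (by positivity) two_ne_zero).1 hsq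

/-! ### Derivative of the involution and change of variables. -/

/-- The complex derivative of the involution `φ_a` at `z`. -/
noncomputable def ballInvolutionDeriv (a z : Cn n) : Cn n →L[ℂ] Cn n :=
  (-(1 - inner ℂ a z : ℂ)⁻¹ * ((Real.sqrt (1 - ‖a‖ ^ 2) : ℝ) : ℂ)) •
    (ContinuousLinearMap.id ℂ (Cn n) + (innerSL ℂ a).smulRight
      (((Real.sqrt (1 - ‖a‖ ^ 2) : ℝ) : ℂ)⁻¹ •
        ((1 + ((Real.sqrt (1 - ‖a‖ ^ 2) : ℝ) : ℂ))⁻¹ • a - ballInvolution a z)))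

theorem hasFDerivAt_ballInvolution {a z : Cn n} (ha : ‖a‖ < 1) (hz : ‖z‖ < 1) :
    HasFDerivAt (ballInvolution a) (ballInvolutionDeriv a z) z := by
  have hp := one_sub_inner_ne_zero ha hz
  have h1 := one_add_sqrt_ne_zero ha
  have h0 : ((Real.sqrt (1 - ‖a‖ ^ 2) : ℝ) : ℂ) ≠ 0 := by exact_mod_cast (sqrt_pos ha).ne'
  have hfun : ballInvolution a = fun z => (1 - innerSL ℂ a z : ℂ)⁻¹ •
      (a - ((Real.sqrt (1 - ‖a‖ ^ 2) : ℝ) : ℂ) • z -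
        (innerSL ℂ a z / (1 + (Real.sqrt (1 - ‖a‖ ^ 2) : ℝ)) : ℂ) • a) := by
    funext w
    exact ballInvolution_eq ha w
  have hD : HasFDerivAt (fun w : Cn n => (1 - innerSL ℂ a w : ℂ)) (-(innerSL ℂ a)) z :=
    ((innerSL ℂ a).hasFDerivAt).const_sub 1
  have hI := (hasDerivAt_inv (x := (1 - innerSL ℂ a z : ℂ)) hp).comp_hasFDerivAt z hD
  have hN1 : HasFDerivAt (fun w : Cn n => a - ((Real.sqrt (1 - ‖a‖ ^ 2) : ℝ) : ℂ) • w)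
      (-(((Real.sqrt (1 - ‖a‖ ^ 2) : ℝ) : ℂ) • ContinuousLinearMap.id ℂ (Cn n))) z :=
    (((Real.sqrt (1 - ‖a‖ ^ 2) : ℝ) : ℂ) • ContinuousLinearMap.id ℂ (Cn n)).hasFDerivAt.const_sub a
  have hN2 := ((((innerSL ℂ a).hasFDerivAt (x := z)).mul_const
    ((1 + (Real.sqrt (1 - ‖a‖ ^ 2) : ℝ) : ℂ)⁻¹)).smul_const a)
  have hT := hI.smul (hN1.sub hN2)
  rw [hfun]
  simp only [div_eq_mul_inv]
  refine hT.congr_fderiv ?_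
  ext1 h
  simp only [ballInvolutionDeriv, ballInvolution_eq ha, add_apply,
    smul_apply, sub_apply, neg_apply,
    ContinuousLinearMap.smulRight_apply, ContinuousLinearMap.id_apply, innerSL_apply_apply,
    Function.comp_apply, smul_eq_mul, Pi.sub_apply]
  set s : ℂ := ((Real.sqrt (1 - ‖a‖ ^ 2) : ℝ) : ℂ)
  generalize (inner ℂ a z : ℂ) = p at *
  generalize (inner ℂ a h : ℂ) = q at *
  match_scalars
  all_goals
    field_simp
    try ring

/-- Up to a scalar the derivative is a transvection x ↦ x + ⟨x, a⟩v, with determinant 1 + ⟨v, a⟩.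
The scalar contributes n factors of the quotient and the transvection one more. -/
theorem norm_det_ballInvolutionDeriv {a z : Cn n} (ha : ‖a‖ < 1) (hz : ‖z‖ < 1) :
    ‖LinearMap.det (ballInvolutionDeriv a z : Cn n →ₗ[ℂ] Cn n)‖ =
      (Real.sqrt (1 - ‖a‖ ^ 2) / ‖(1 - inner ℂ a z : ℂ)‖) ^ (n + 1) := by
  have hs := ofReal_sqrt_sq ha
  have h1 := one_add_sqrt_ne_zero ha
  have hsp := sqrt_pos ha
  have h0 : ((Real.sqrt (1 - ‖a‖ ^ 2) : ℝ) : ℂ) ≠ 0 := by exact_mod_cast hsp.ne'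
  have h4 := one_sub_inner_ballInvolution_right ha hz
  have h5 : (inner ℂ a (ballInvolution a z) : ℂ) = 1 - (1 - inner ℂ a a) / (1 - inner ℂ a z) := by
    rw [← h4]; ring
  have hp := one_sub_inner_ne_zero ha hz
  set v : Cn n := (((Real.sqrt (1 - ‖a‖ ^ 2) : ℝ) : ℂ)⁻¹ •
        ((1 + ((Real.sqrt (1 - ‖a‖ ^ 2) : ℝ) : ℂ))⁻¹ • a - ballInvolution a z)) with hv
  have hE : (ballInvolutionDeriv a z : Cn n →ₗ[ℂ] Cn n) =
      (-(1 - inner ℂ a z : ℂ)⁻¹ * ((Real.sqrt (1 - ‖a‖ ^ 2) : ℝ) : ℂ)) •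
        LinearMap.transvection (innerSL ℂ a : Cn n →ₗ[ℂ] ℂ) v := rfl
  rw [hE, LinearMap.det_smul, LinearMap.transvection.det, finrank_euclideanSpace_fin]
  have hval : (1 + (innerSL ℂ a : Cn n →ₗ[ℂ] ℂ) v : ℂ) =
      ((Real.sqrt (1 - ‖a‖ ^ 2) : ℝ) : ℂ) * (1 - inner ℂ a z : ℂ)⁻¹ := by
    change (1 + inner ℂ a v : ℂ) = _
    rw [hv, inner_smul_right, inner_sub_right, inner_smul_right, h5]
    rw [← hs]
    have haa : (inner ℂ a a : ℂ) = 1 - ((Real.sqrt (1 - ‖a‖ ^ 2) : ℝ) : ℂ) ^ 2 := by rw [hs]; ring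
    rw [haa]
    field_simp
    ring
  rw [hval, norm_mul, norm_pow, norm_mul, norm_mul, norm_neg, norm_inv, Complex.norm_real,
    Real.norm_of_nonneg hsp.le, div_eq_mul_inv, pow_succ _ n, mul_comm (Real.sqrt _) (_⁻¹)]

theorem image_ballInvolution {a : Cn n} (ha : ‖a‖ < 1) :
    ballInvolution a '' ball 0 1 = ball 0 1 := by
  ext w
  simp only [Set.mem_image, mem_ball_zero_iff]
  constructor
  · rintro ⟨z, hz, rfl⟩
    exact norm_ballInvolution_lt ha hz
  · intro hw
    exact ⟨_, norm_ballInvolution_lt ha hw, ballInvolution_ballInvolution ha hw⟩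

theorem injOn_ballInvolution {a : Cn n} (ha : ‖a‖ < 1) :
    Set.InjOn (ballInvolution a) (ball 0 1) := by
  intro z hz w hw h
  rw [← ballInvolution_ballInvolution ha (mem_ball_zero_iff.1 hz), h,
    ballInvolution_ballInvolution ha (mem_ball_zero_iff.1 hw)]

/-- The real Jacobian determinant of the involution `φ_a` at `z`. -/
noncomputable def jacobian (a z : Cn n) : ℝ :=
  ((1 - ‖a‖ ^ 2) / ‖(1 - inner ℂ a z : ℂ)‖ ^ 2) ^ (n + 1)

theorem lintegral_image_ballInvolution {a : Cn n} (ha : ‖a‖ < 1) {s : Set (Cn n)}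
    (hs : MeasurableSet s) (hsb : s ⊆ ball 0 1) (g : Cn n → ℝ≥0∞) :
    ∫⁻ z in ballInvolution a '' s, g z =
      ∫⁻ z in s, ENNReal.ofReal (jacobian a z) * g (ballInvolution a z) := by
  rw [lintegral_image_eq_lintegral_abs_det_fderiv_mul volume hs
    (f' := fun z => (ballInvolutionDeriv a z).restrictScalars ℝ) (fun z hz =>
      ((hasFDerivAt_ballInvolution ha
        (mem_ball_zero_iff.1 (hsb hz))).restrictScalars ℝ).hasFDerivWithinAt)
    ((injOn_ballInvolution ha).mono hsb)]
  refine setLIntegral_congr_fun hs fun z hz => ?_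
  have hz1 := mem_ball_zero_iff.1 (hsb hz)
  -- The real determinant of a complex linear map is the squared modulus of its complex determinant,
  -- which removes the square root.
  have hdet : |((ballInvolutionDeriv a z).restrictScalars ℝ).det| = jacobian a z := by
    change |LinearMap.det ((ballInvolutionDeriv a z : Cn n →ₗ[ℂ] Cn n).restrictScalars ℝ)| = _
    have e := LinearMap.det_restrictScalars (R := ℝ) (S := ℂ)
      (f := (ballInvolutionDeriv a z : Cn n →ₗ[ℂ] Cn n))
    rw [e, Algebra.norm_complex_apply, Complex.normSq_eq_norm_sq,
      norm_det_ballInvolutionDeriv ha hz1, abs_of_nonneg (sq_nonneg _), ← pow_mul, mul_comm,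
      pow_mul, div_pow, Real.sq_sqrt (one_sub_sq_norm_pos ha).le, jacobian]
  simp only [hdet]

/-! ### The Bergman norm, the kernels and the isometric action of the involutions. -/

/-- The norm of `f` in the weighted Bergman space `B_α^1`, up to normalization. -/
noncomputable def bergmanNorm (α : ℝ) (f : Cn n → ℂ) : ℝ≥0∞ :=
  ∫⁻ z in ball 0 1, ‖f z‖ₑ * ENNReal.ofReal ((1 - ‖z‖ ^ 2) ^ α)

theorem continuousOn_weight (α : ℝ) :
    ContinuousOn (fun z : Cn n => (1 - ‖z‖ ^ 2) ^ α) (ball 0 1) :=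
  ContinuousOn.rpow_const (by fun_prop) fun _ hz =>
    Or.inl (one_sub_sq_norm_pos (mem_ball_zero_iff.1 hz)).ne'

theorem measurable_weight (α : ℝ) :
    Measurable (fun z : Cn n => ENNReal.ofReal ((1 - ‖z‖ ^ 2) ^ α)) := by
  fun_prop

theorem memBergman_one_iff {α : ℝ} {f : Cn n → ℂ} :
    MemBergman n 1 α f ↔ DifferentiableOn ℂ f (ball 0 1) ∧ bergmanNorm α f < ∞ := by
  refine and_congr_right fun hf => ?_
  have hpos : 0 < volume (ball (0 : Cn n) 1) := measure_ball_pos _ _ one_pos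
  have hfin : volume (ball (0 : Cn n) 1) < ∞ := measure_ball_lt_top
  rw [memLp_one_iff_integrable, ballMeasure,
    integrable_smul_measure (ENNReal.inv_ne_zero.2 hfin.ne) (ENNReal.inv_ne_top.2 hpos.ne')]
  have hm : AEStronglyMeasurable (fun z => (1 - ‖z‖ ^ 2) ^ α • f z)
      (volume.restrict (ball (0 : Cn n) 1)) :=
    ((continuousOn_weight α).smul hf.continuousOn).aestronglyMeasurable measurableSet_ball
  rw [Integrable, and_iff_right hm, HasFiniteIntegral, bergmanNorm]
  have : ∫⁻ z in ball (0 : Cn n) 1, ‖(1 - ‖z‖ ^ 2) ^ α • f z‖ₑ =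
      ∫⁻ z in ball (0 : Cn n) 1, ‖f z‖ₑ * ENNReal.ofReal ((1 - ‖z‖ ^ 2) ^ α) := by
    refine setLIntegral_congr_fun measurableSet_ball fun z hz => ?_
    have h := one_sub_sq_norm_pos (mem_ball_zero_iff.1 hz)
    simp only [enorm_smul]
    rw [mul_comm, Real.enorm_of_nonneg (by positivity)]
  rw [this]

/-- The kernel `(1 - |a|²)^t (1 - z ā)^{-2t}`. -/
noncomputable def bergmanKernel (t : ℝ) (a z : Cn n) : ℂ :=
  (((1 - ‖a‖ ^ 2) ^ t : ℝ) : ℂ) * (1 - inner ℂ a z : ℂ) ^ ((-(2 * t) : ℝ) : ℂ)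

theorem norm_bergmanKernel {t : ℝ} {a z : Cn n} (ha : ‖a‖ < 1) :
    ‖bergmanKernel t a z‖ = ((1 - ‖a‖ ^ 2) / ‖(1 - inner ℂ a z : ℂ)‖ ^ 2) ^ t := by
  have h1 := one_sub_sq_norm_pos ha
  rw [bergmanKernel, norm_mul, Complex.norm_real, Complex.norm_cpow_real,
    Real.norm_of_nonneg (by positivity), Real.div_rpow h1.le (by positivity),
    Real.rpow_neg (by positivity), Real.rpow_mul (by positivity), Real.rpow_two, div_eq_mul_inv]

/-- The base 1 - z ā has positive real part on the ball, so it avoids the branch cut of the complex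
power. -/
theorem hasFDerivAt_bergmanKernel (t : ℝ) {a z : Cn n} (ha : ‖a‖ < 1) (hz : ‖z‖ < 1) :
    HasFDerivAt (bergmanKernel t a)
      (((((1 - ‖a‖ ^ 2) ^ t : ℝ) : ℂ) * (((-(2 * t) : ℝ) : ℂ) *
        (1 - inner ℂ a z : ℂ) ^ (((-(2 * t) : ℝ) : ℂ) - 1))) • -(innerSL ℂ a)) z := by
  have hD : HasFDerivAt (fun w : Cn n => (1 - innerSL ℂ a w : ℂ)) (-(innerSL ℂ a)) z :=
    ((innerSL ℂ a).hasFDerivAt).const_sub 1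
  have h := (Complex.hasStrictDerivAt_cpow_const (c := ((-(2 * t) : ℝ) : ℂ))
    (x := 1 - innerSL ℂ a z) (Or.inl (one_sub_inner_re_pos ha hz))).hasDerivAt
  exact ((h.comp_hasFDerivAt z hD).const_mul (((1 - ‖a‖ ^ 2) ^ t : ℝ) : ℂ)).congr_fderiv
    (smul_smul _ _ _)

theorem differentiableOn_bergmanKernel (t : ℝ) {a : Cn n} (ha : ‖a‖ < 1) :
    DifferentiableOn ℂ (bergmanKernel t a) (ball 0 1) := fun _ hz =>
  (hasFDerivAt_bergmanKernel t ha (mem_ball_zero_iff.1 hz)).differentiableAt.differentiableWithinAt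

theorem differentiableOn_pullback (t : ℝ) {a : Cn n} (ha : ‖a‖ < 1) {f : Cn n → ℂ}
    (hf : DifferentiableOn ℂ f (ball 0 1)) :
    DifferentiableOn ℂ (fun u => bergmanKernel t a u * f (ballInvolution a u)) (ball 0 1) := by
  refine (differentiableOn_bergmanKernel t ha).mul (hf.comp (fun z hz => ?_) fun z hz => ?_)
  · exact (hasFDerivAt_ballInvolution ha
      (mem_ball_zero_iff.1 hz)).differentiableAt.differentiableWithinAt
  · exact mem_ball_zero_iff.2 (norm_ballInvolution_lt ha (mem_ball_zero_iff.1 hz))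

/-- The weighted composition with `φ_a` preserves the norm of `B_α^1`. -/
theorem bergmanNorm_pullback (α : ℝ) {a : Cn n} (ha : ‖a‖ < 1) (f : Cn n → ℂ) :
    bergmanNorm α (fun u => bergmanKernel ((n : ℝ) + 1 + α) a u * f (ballInvolution a u)) =
      bergmanNorm α f := by
  have key := lintegral_image_ballInvolution ha measurableSet_ball subset_rfl
    (fun z => ‖f z‖ₑ * ENNReal.ofReal ((1 - ‖z‖ ^ 2) ^ α))
  rw [image_ballInvolution ha] at key
  rw [bergmanNorm, bergmanNorm, key]
  refine setLIntegral_congr_fun measurableSet_ball fun u hu => ?_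
  have hu1 := mem_ball_zero_iff.1 hu
  have h1 := one_sub_sq_norm_pos ha
  have h2 := one_sub_sq_norm_pos hu1
  have h3 := one_sub_inner_norm_pos ha hu1
  simp only [enorm_mul]
  rw [← ofReal_norm (bergmanKernel _ a u), norm_bergmanKernel ha,
    one_sub_norm_sq_ballInvolution ha hu1, jacobian, mul_assoc, mul_left_comm,
    mul_left_comm (ENNReal.ofReal (_ ^ (n + 1))), ← ENNReal.ofReal_mul (by positivity), ← ENNReal.ofReal_mul (by positivity)]
  congr 2
  -- With q = (1 - |a|²)/|1 - u ā|², the Jacobian gives q^(n+1) and the weight gives q^α; their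
  -- product is the modulus of the kernel.
  rw [mul_div_right_comm, Real.mul_rpow (by positivity) h2.le, Real.rpow_add (by positivity),
    ← mul_assoc]
  congr 2
  exact_mod_cast Real.rpow_natCast _ (n + 1)

/-- Polar coordinates reduce this to the integral of y^(2n-1) (1 + y)^α (1 - y)^α over (0, 1). The
first two factors are bounded there, and the last is integrable because α > -1. -/
theorem bergmanNorm_one_lt_top (hn : 1 ≤ n) {α : ℝ} (hα : -1 < α) :
    bergmanNorm α (fun _ : Cn n => (1 : ℂ)) < ∞ := by
  have : Nonempty (Fin n) := ⟨⟨0, hn⟩⟩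
  have hI : IntegrableOn (fun z : Cn n => (1 - ‖z‖ ^ 2) ^ α) (ball 0 1) := by
    refine (integrableOn_fun_norm_addHaar volume (f := fun y : ℝ => (1 - y ^ 2) ^ α)).2 ?_
    have h1 : IntegrableOn (fun y : ℝ => (1 - y) ^ α) (Set.Ioo 0 1) := by
      have := (intervalIntegral.intervalIntegrable_rpow' (a := 0) (b := 1) hα).comp_sub_left 1
      rw [sub_zero, sub_self, intervalIntegrable_iff, Set.uIoc_comm,
        Set.uIoc_of_le zero_le_one] at this
      exact this.mono_set Set.Ioo_subset_Ioc_self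
    refine Integrable.mono' (h1.const_mul (max 1 (2 ^ α))) ?_ ?_
    · exact Measurable.aestronglyMeasurable (by fun_prop)
    · refine (ae_restrict_iff' measurableSet_Ioo).2 (Filter.Eventually.of_forall fun y hy => ?_)
      obtain ⟨hy0, hy1⟩ := hy
      have e1 : 0 < 1 - y := by linarith
      have e2 : (1 - y ^ 2 : ℝ) = (1 + y) * (1 - y) := by ring
      rw [e2, Real.mul_rpow (by linarith) e1.le, smul_eq_mul, Real.norm_of_nonneg (by positivity)]
      have e3 : y ^ (Module.finrank ℝ (Cn n) - 1) ≤ 1 := pow_le_one₀ hy0.le hy1.le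
      have e4 : (1 + y) ^ α ≤ max 1 (2 ^ α) := by
        rcases le_total 0 α with h | h
        · exact (Real.rpow_le_rpow (by linarith) (by linarith) h).trans (le_max_right _ _)
        · exact (Real.rpow_le_one_of_one_le_of_nonpos (by linarith) h).trans (le_max_left _ _)
      have e5 : 0 ≤ (1 + y) ^ α * (1 - y) ^ α := by positivity
      calc y ^ (Module.finrank ℝ (Cn n) - 1) * ((1 + y) ^ α * (1 - y) ^ α)
          ≤ 1 * ((1 + y) ^ α * (1 - y) ^ α) := by gcongr
        _ ≤ _ := by rw [one_mul]; gcongr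
  have := hI.2
  rw [HasFiniteIntegral] at this
  refine lt_of_eq_of_lt ?_ this
  refine setLIntegral_congr_fun measurableSet_ball fun z hz => ?_
  have h := one_sub_sq_norm_pos (mem_ball_zero_iff.1 hz)
  simp only [enorm_one, one_mul]
  rw [Real.enorm_of_nonneg (by positivity)]

/-! ### Mean value inequality and local estimates at the origin. -/

theorem lintegral_ball_smul {c : ℂ} (hc : ‖c‖ = 1) (F : Cn n → ℝ≥0∞) (r : ℝ) :
    ∫⁻ h in ball (0 : Cn n) r, F (c • h) = ∫⁻ h in ball (0 : Cn n) r, F h := by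
  have hc0 : c ≠ 0 := fun h => by simp [h] at hc
  let e : Cn n ≃ₗᵢ[ℝ] Cn n :=
    { (LinearEquiv.smulOfNeZero ℂ (Cn n) c hc0).restrictScalars ℝ with
      norm_map' := fun x => by
        change ‖c • x‖ = ‖x‖
        rw [norm_smul, hc, one_mul] }
  have h := e.measurePreserving.setLIntegral_comp_preimage_emb
    e.toHomeomorph.measurableEmbedding F (ball 0 r)
  rw [e.preimage_ball, map_zero] at h
  exact h

/-- The one-variable mean value property on the disc ζ ↦ x + ζh. -/
theorem mul_enorm_le_lintegral_circle {f : Cn n → ℂ} (hf : DifferentiableOn ℂ f (ball 0 1))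
    {x h : Cn n} (hxh : ‖x‖ + ‖h‖ < 1) :
    ENNReal.ofReal (2 * Real.pi) * ‖f x‖ₑ ≤
      ∫⁻ θ in Set.Ioc 0 (2 * Real.pi), ‖f (x + circleMap 0 1 θ • h)‖ₑ := by
  have hmem : ∀ ζ : ℂ, ‖ζ‖ ≤ 1 → x + ζ • h ∈ ball (0 : Cn n) 1 := fun ζ hζ => by
    rw [mem_ball_zero_iff]
    calc ‖x + ζ • h‖ ≤ ‖x‖ + ‖ζ • h‖ := norm_add_le _ _
      _ ≤ ‖x‖ + 1 * ‖h‖ := by rw [norm_smul]; gcongr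
      _ < 1 := by linarith
  have hg : DifferentiableOn ℂ (fun ζ : ℂ => f (x + ζ • h)) (closedBall 0 1) :=
    hf.comp (by fun_prop) fun ζ hζ => hmem ζ (mem_closedBall_zero_iff.1 hζ)
  have hd : DiffContOnCl ℂ (fun ζ : ℂ => f (x + ζ • h)) (ball 0 |1|) := by
    rw [abs_one]
    exact hg.diffContOnCl_ball subset_rfl
  have hc := hd.circleAverage
  simp only [Real.circleAverage, zero_smul, add_zero] at hc
  have hpi : (0 : ℝ) < 2 * Real.pi := by positivity
  have h2 : (2 * Real.pi) • f x =
      ∫ θ in Set.Ioc 0 (2 * Real.pi), f (x + circleMap 0 1 θ • h) := by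
    rw [← intervalIntegral.integral_of_le hpi.le, ← hc, smul_smul, mul_inv_cancel₀ hpi.ne',
      one_smul]
  calc ENNReal.ofReal (2 * Real.pi) * ‖f x‖ₑ = ‖(2 * Real.pi) • f x‖ₑ := by
        rw [enorm_smul, Real.enorm_of_nonneg hpi.le]
    _ ≤ _ := by
        rw [h2]
        exact enorm_integral_le_lintegral_enorm _

/-- Integrate the circle inequality over h and exchange the integrals: multiplication by a
unimodular scalar preserves the ball, so the inner integral does not depend on θ and the factor 2π
cancels. -/
theorem volume_mul_enorm_le_lintegral {f : Cn n → ℂ} (hf : DifferentiableOn ℂ f (ball 0 1))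
    {x : Cn n} {r : ℝ} (hr : ‖x‖ + r ≤ 1) :
    volume (ball (0 : Cn n) r) * ‖f x‖ₑ ≤ ∫⁻ h in ball (0 : Cn n) r, ‖f (x + h)‖ₑ := by
  have hpi : (0 : ℝ) < 2 * Real.pi := by positivity
  have hswap : ∫⁻ h in ball (0 : Cn n) r, ∫⁻ θ in Set.Ioc 0 (2 * Real.pi),
        ‖f (x + circleMap 0 1 θ • h)‖ₑ =
      ∫⁻ θ in Set.Ioc 0 (2 * Real.pi), ∫⁻ h in ball (0 : Cn n) r,
        ‖f (x + circleMap 0 1 θ • h)‖ₑ := by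
    refine lintegral_lintegral_swap ?_
    rw [Measure.prod_restrict]
    refine (ContinuousOn.aemeasurable ?_ (measurableSet_ball.prod measurableSet_Ioc)).enorm
    refine hf.continuousOn.comp (by fun_prop) ?_
    rintro ⟨h, θ⟩ ⟨hh, -⟩
    have hh' := mem_ball_zero_iff.1 hh
    rw [mem_ball_zero_iff]
    calc ‖x + circleMap 0 1 θ • h‖ ≤ ‖x‖ + ‖circleMap 0 1 θ • h‖ := norm_add_le _ _
      _ = ‖x‖ + ‖h‖ := by rw [norm_smul, norm_circleMap_zero, abs_one, one_mul]
      _ < 1 := by simp only at hh'; linarith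
  have hrot : ∀ θ : ℝ, ∫⁻ h in ball (0 : Cn n) r, ‖f (x + circleMap 0 1 θ • h)‖ₑ =
      ∫⁻ h in ball (0 : Cn n) r, ‖f (x + h)‖ₑ := fun θ =>
    lintegral_ball_smul (by rw [norm_circleMap_zero, abs_one]) (fun h => ‖f (x + h)‖ₑ) r
  have hle : ∫⁻ _ in ball (0 : Cn n) r, ENNReal.ofReal (2 * Real.pi) * ‖f x‖ₑ ≤
      ∫⁻ h in ball (0 : Cn n) r, ∫⁻ θ in Set.Ioc 0 (2 * Real.pi),
        ‖f (x + circleMap 0 1 θ • h)‖ₑ :=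
    setLIntegral_mono' measurableSet_ball fun h hh =>
      mul_enorm_le_lintegral_circle hf (by linarith [mem_ball_zero_iff.1 hh])
  rw [hswap] at hle
  simp only [hrot, setLIntegral_const, Real.volume_Ioc, sub_zero] at hle
  rw [mul_assoc, mul_comm _ (ENNReal.ofReal _),
    ENNReal.mul_le_mul_iff_right (by simpa using hpi) ENNReal.ofReal_ne_top] at hle
  rwa [mul_comm]

/-- Point evaluations are bounded on `B_α^1`, uniformly on the ball of radius `1/2`. -/
theorem exists_norm_le_bergmanNorm (n : ℕ) (α : ℝ) : ∃ C : ℝ, 0 < C ∧ ∀ f : Cn n → ℂ,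
    DifferentiableOn ℂ f (ball 0 1) → bergmanNorm α f < ∞ → ∀ x : Cn n, ‖x‖ ≤ 1 / 2 →
      ‖f x‖ ≤ C * (bergmanNorm α f).toReal := by
  set V := volume (ball (0 : Cn n) (1 / 4)) with hV
  have hV0 : V ≠ 0 := (measure_ball_pos _ _ (by norm_num)).ne'
  have hVt : V ≠ ∞ := measure_ball_lt_top.ne
  have hVr : 0 < V.toReal := ENNReal.toReal_pos hV0 hVt
  -- A ball of radius 1/4 about a point of norm at most 1/2 lies in |z| < 3/4, where 1 - |z|² is
  -- between 7/16 and 1. The minimum bounds the weight below for either sign of α.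
  set m : ℝ := min 1 ((7 / 16) ^ α) with hm
  have hm0 : 0 < m := lt_min one_pos (by positivity)
  have hw : ∀ z : Cn n, ‖z‖ < 3 / 4 → m ≤ (1 - ‖z‖ ^ 2) ^ α := fun z hz => by
    have h1 : (7 : ℝ) / 16 ≤ 1 - ‖z‖ ^ 2 := by nlinarith [norm_nonneg z]
    have h2 : 1 - ‖z‖ ^ 2 ≤ 1 := by nlinarith [norm_nonneg z]
    rcases le_total 0 α with h | h
    · exact (min_le_right _ _).trans (Real.rpow_le_rpow (by norm_num) h1 h)
    · exact (min_le_left _ _).trans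
        (Real.one_le_rpow_of_pos_of_le_one_of_nonpos (by linarith) h2 h)
  refine ⟨(m * V.toReal)⁻¹, by positivity, fun f hf hfin x hx => ?_⟩
  have h1 := volume_mul_enorm_le_lintegral hf (x := x) (r := 1 / 4) (by linarith)
  have h2 : ENNReal.ofReal m * ∫⁻ h in ball (0 : Cn n) (1 / 4), ‖f (x + h)‖ₑ ≤
      bergmanNorm α f := by
    rw [← lintegral_const_mul' _ _ ENNReal.ofReal_ne_top, ← lintegral_indicator measurableSet_ball,
      bergmanNorm, ← lintegral_indicator measurableSet_ball,
      ← lintegral_add_left_eq_self ((ball (0 : Cn n) 1).indicator _) x]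
    refine lintegral_mono fun h => ?_
    by_cases hh : h ∈ ball (0 : Cn n) (1 / 4)
    · have h3 : ‖x + h‖ < 3 / 4 := (norm_add_le _ _).trans_lt
        (by linarith [mem_ball_zero_iff.1 hh])
      have h4 : x + h ∈ ball (0 : Cn n) 1 := mem_ball_zero_iff.2 (by linarith)
      rw [Set.indicator_of_mem hh, Set.indicator_of_mem h4, mul_comm]
      gcongr
      exact hw _ h3
    · rw [Set.indicator_of_notMem hh]
      exact zero_le
  have h3 : ENNReal.ofReal m * (V * ‖f x‖ₑ) ≤ bergmanNorm α f :=
    (mul_le_mul_right h1 _).trans h2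
  have h4 := ENNReal.toReal_mono hfin.ne h3
  rw [ENNReal.toReal_mul, ENNReal.toReal_mul, ENNReal.toReal_ofReal hm0.le, toReal_enorm,
    ← mul_assoc] at h4
  rwa [inv_mul_eq_div, le_div_iff₀ (by positivity), mul_comm]

/-- The Schwarz lemma on the ball of radius 1/2, where f - f(0) is at most 2C times the norm;
dividing by the radius gives 4C. -/
theorem exists_dist_le_bergmanNorm (n : ℕ) (α : ℝ) : ∃ C : ℝ, 0 < C ∧ ∀ f : Cn n → ℂ,
    DifferentiableOn ℂ f (ball 0 1) → bergmanNorm α f < ∞ → ∀ u : Cn n, ‖u‖ < 1 / 2 →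
      ‖f 0 - f u‖ ≤ C * (bergmanNorm α f).toReal * ‖u‖ := by
  obtain ⟨C, hC, h⟩ := exists_norm_le_bergmanNorm n α
  refine ⟨4 * C, by positivity, fun f hf hfin u hu => ?_⟩
  have hb := h f hf hfin
  have := Complex.dist_le_div_mul_dist_of_mapsTo_ball (f := f) (c := 0) (R₁ := 1 / 2) (z := u)
    (R₂ := 2 * (C * (bergmanNorm α f).toReal)) (hf.mono (ball_subset_ball (by norm_num)))
    (fun x hx => by
      rw [mem_closedBall, dist_eq_norm]
      have e1 := hb x (mem_ball_zero_iff.1 hx).le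
      have e2 := hb 0 (by simp)
      linarith [norm_sub_le (f x) (f 0)]) (mem_ball_zero_iff.2 hu)
  rw [dist_eq_norm, dist_zero_right, norm_sub_rev] at this
  calc _ ≤ _ := this
    _ = _ := by ring

/-! ### Interpolating sequences are separated. -/

/-- An interpolating sequence is separated. -/
theorem IsInterpolatingSeq.isSeparatedSeq {α : ℝ} {κ : Type*} {a : κ → Cn n}
    (ha : ∀ k, ‖a k‖ < 1) (h : IsInterpolatingSeq 1 α a) : IsSeparatedSeq a := by
  classical
  obtain ⟨C, hC, hdist⟩ := exists_dist_le_bergmanNorm n α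
  set t : ℝ := (n : ℝ) + 1 + α with ht
  set w : κ → ℝ := fun k => (1 - ‖a k‖ ^ 2) ^ t with hw
  have hw0 : ∀ k, 0 < w k := fun k => Real.rpow_pos_of_pos (one_sub_sq_norm_pos (ha k)) _
  -- Let f interpolate the values x_k / w_k. Its pullback by φ_{a_k} has the same norm and takes at
  -- 0 and at φ_{a_k}(a_j) the two values compared here. Thus M depends on x but not on the pair.
  have hpair : ∀ x : lp (fun _ : κ => ℂ) 1, ∃ M : ℝ, ∀ k j, invDist (a k) (a j) < 1 / 2 →
      ‖x k - bergmanKernel t (a k) (ballInvolution (a k) (a j)) * ((w j)⁻¹ : ℝ) * x j‖ ≤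
        M * invDist (a k) (a j) := by
    intro x
    have hcancel : ∀ k, (w k : ℂ) * (((w k)⁻¹ : ℝ) * x k) = x k := fun k => by
      rw [← mul_assoc, ← Complex.ofReal_mul, mul_inv_cancel₀ (hw0 k).ne', Complex.ofReal_one,
        one_mul]
    obtain ⟨f, hf, hfv⟩ := h (fun k => ((w k)⁻¹ : ℝ) * x k) (by
      have hx := lp.memℓp x
      rw [MemWeightedLp, ENNReal.toReal_one, div_one, ← ht]
      convert hx using 2 with k
      rw [Complex.real_smul]
      exact hcancel k)
    obtain ⟨hfd, hfn⟩ := memBergman_one_iff.1 hf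
    refine ⟨C * (bergmanNorm α f).toReal, fun k j hkj => ?_⟩
    have hiso := bergmanNorm_pullback α (ha k) f
    have := hdist _ (differentiableOn_pullback t (ha k) hfd) (by rw [hiso]; exact hfn)
      (ballInvolution (a k) (a j)) hkj
    rw [hiso, ballInvolution_zero (ha k), ballInvolution_ballInvolution (ha k) (ha j), hfv,
      hfv] at this
    have h0 : bergmanKernel t (a k) 0 = (w k : ℂ) := by simp [bergmanKernel, hw]
    rw [h0, hcancel, ← mul_assoc] at this
    exact this
  -- These difference quotients are bounded functionals on ℓ¹, pointwise bounded by the previous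
  -- estimate. The uniform boundedness principle thus needs no norm control on the interpolating
  -- function.
  let g : {p : κ × κ // p.1 ≠ p.2 ∧ invDist (a p.1) (a p.2) < 1 / 2} →
      lp (fun _ : κ => ℂ) 1 →L[ℂ] ℂ := fun p =>
    ((invDist (a p.1.1) (a p.1.2))⁻¹ : ℂ) • (lp.evalCLM ℂ (fun _ : κ => ℂ) 1 p.1.1 -
      (bergmanKernel t (a p.1.1) (ballInvolution (a p.1.1) (a p.1.2)) * ((w p.1.2)⁻¹ : ℝ)) •
        lp.evalCLM ℂ (fun _ : κ => ℂ) 1 p.1.2)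
  have hg : ∀ p x, g p x = ((invDist (a p.1.1) (a p.1.2))⁻¹ : ℂ) * (x p.1.1 -
      bergmanKernel t (a p.1.1) (ballInvolution (a p.1.1) (a p.1.2)) * ((w p.1.2)⁻¹ : ℝ) *
        x p.1.2) := fun p x => rfl
  obtain ⟨B, hB⟩ := banach_steinhaus (g := g) (fun x => by
    obtain ⟨M, hM⟩ := hpair x
    refine ⟨|M|, fun p => ?_⟩
    have h1 := hM p.1.1 p.1.2 p.2.2
    have h0 := invDist_nonneg (a p.1.1) (a p.1.2)
    rw [hg, norm_mul, norm_inv, Complex.norm_real, Real.norm_of_nonneg h0]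
    rcases h0.eq_or_lt with h2 | h2
    -- At distance zero the convention `0⁻¹ = 0` makes the functional vanish; coinciding points are
    -- excluded separately below.
    · rw [← h2, inv_zero, zero_mul]
      exact abs_nonneg M
    · rw [inv_mul_le_iff₀ h2]
      exact (h1.trans (mul_le_mul_of_nonneg_right (le_abs_self M) h0)).trans_eq (mul_comm _ _))
  refine ⟨min (1 / 2) (|B| + 1)⁻¹, by positivity, fun k j hkj => ?_⟩
  by_contra! hlt
  have hd2 : invDist (a k) (a j) < 1 / 2 := hlt.trans_le (min_le_left _ _)
  have hdB : invDist (a k) (a j) < (|B| + 1)⁻¹ := hlt.trans_le (min_le_right _ _)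
  -- On the k-th unit vector the functional of the pair (k, j) equals 1/d(a_k, a_j), which is
  -- therefore at most B.
  set x : lp (fun _ : κ => ℂ) 1 := lp.single 1 k 1 with hx
  have hxk : x k = 1 := by simp [hx]
  have hxj : x j = 0 := by simp [hx, lp.single_apply, Pi.single_eq_of_ne hkj.symm]
  have hnx : ‖x‖ = 1 := by rw [hx, lp.norm_single one_pos, norm_one]
  have hpos : 0 < invDist (a k) (a j) := by
    refine (invDist_nonneg _ _).lt_of_ne fun h0 => ?_
    obtain ⟨M, hM⟩ := hpair x
    have := hM k j hd2
    rw [hxk, hxj, ← h0, mul_zero, mul_zero, sub_zero, norm_one] at this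
    linarith
  have h1 := (g ⟨(k, j), hkj, hd2⟩).le_of_opNorm_le (hB _) x
  rw [hg, hnx, mul_one] at h1
  simp only [hxk, hxj, mul_zero, sub_zero, mul_one, norm_inv, Complex.norm_real] at h1
  rw [Real.norm_of_nonneg hpos.le] at h1
  have h2 : (|B| + 1) < (invDist (a k) (a j))⁻¹ := by
    rw [lt_inv_comm₀ (by positivity) hpos]
    exact hdB
  linarith [le_abs_self B]

/-! ### Volume packing for separated sequences. -/

theorem measurableSet_image_ballInvolution {a : Cn n} (ha : ‖a‖ < 1) {s : Set (Cn n)}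
    (hs : MeasurableSet s) (hsb : s ⊆ ball 0 1) : MeasurableSet (ballInvolution a '' s) :=
  measurable_image_of_fderivWithin hs
    (f' := fun z => (ballInvolutionDeriv a z).restrictScalars ℝ) (fun _ hz =>
      ((hasFDerivAt_ballInvolution ha
        (mem_ball_zero_iff.1 (hsb hz))).restrictScalars ℝ).hasFDerivWithinAt)
    ((injOn_ballInvolution ha).mono hsb)

/-- A lower bound for the weighted volume of an invariant ball. After the change of variables it
follows from |1 - u c̄| ≤ 2, whose square is the source of 4⁻¹. -/
theorem mul_lintegral_le_lintegral_image {α : ℝ} (hα : 0 < (n : ℝ) + 1 + α) {c : Cn n}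
    (hc : ‖c‖ < 1) {r : ℝ} (hr : r ≤ 1) :
    ENNReal.ofReal ((1 - ‖c‖ ^ 2) ^ ((n : ℝ) + 1 + α)) *
        (ENNReal.ofReal (4⁻¹ ^ ((n : ℝ) + 1 + α)) *
          ∫⁻ u in ball (0 : Cn n) r, ENNReal.ofReal ((1 - ‖u‖ ^ 2) ^ α)) ≤
      ∫⁻ w in ballInvolution c '' ball 0 r, ENNReal.ofReal ((1 - ‖w‖ ^ 2) ^ α) := by
  have hcp := one_sub_sq_norm_pos hc
  rw [lintegral_image_ballInvolution hc measurableSet_ball (ball_subset_ball hr), ← mul_assoc,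
    ← ENNReal.ofReal_mul (by positivity), ← lintegral_const_mul' _ _ ENNReal.ofReal_ne_top]
  refine setLIntegral_mono' measurableSet_ball fun u hu => ?_
  have hu1 : ‖u‖ < 1 := (mem_ball_zero_iff.1 hu).trans_le hr
  have hup := one_sub_sq_norm_pos hu1
  have h3 := one_sub_inner_norm_pos hc hu1
  have h4 := one_sub_inner_norm_le hc hu1
  rw [one_sub_norm_sq_ballInvolution hc hu1, jacobian, ← ENNReal.ofReal_mul (by positivity),
    ← ENNReal.ofReal_mul (by positivity)]
  refine ENNReal.ofReal_le_ofReal ?_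
  rw [mul_div_right_comm, Real.mul_rpow (by positivity) hup.le, ← mul_assoc,
    ← Real.mul_rpow hcp.le (by norm_num)]
  refine mul_le_mul_of_nonneg_right ?_ (by positivity)
  set q := (1 - ‖c‖ ^ 2) / ‖(1 - inner ℂ c u : ℂ)‖ ^ 2 with hq
  have hq0 : 0 < q := by positivity
  have e1 : q ^ (n + 1) * q ^ α = q ^ ((n : ℝ) + 1 + α) := by
    rw [Real.rpow_add hq0]
    congr 1
    exact_mod_cast (Real.rpow_natCast q (n + 1)).symm
  rw [e1]
  refine Real.rpow_le_rpow (by positivity) ?_ hα.le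
  rw [hq, div_eq_mul_inv]
  gcongr
  nlinarith

/-- Invariant balls of a fixed small radius about the points are disjoint, and the whole ball has
finite weighted volume. It is essential that C depends on the family only through δ, so that it also
serves all images of the family under the involutions. -/
theorem exists_sum_rpow_le (hn : 1 ≤ n) {α : ℝ} (hα : -1 < α) {δ : ℝ} (hδ : 0 < δ) :
    ∃ C : ℝ, 0 ≤ C ∧ ∀ {κ : Type*} (c : κ → Cn n), (∀ k, ‖c k‖ < 1) →
      (∀ j k, j ≠ k → δ ≤ invDist (c j) (c k)) → ∀ F : Finset κ,
        ∑ k ∈ F, (1 - ‖c k‖ ^ 2) ^ ((n : ℝ) + 1 + α) ≤ C := by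
  have ht : 0 < (n : ℝ) + 1 + α := by
    have : (0 : ℝ) ≤ n := n.cast_nonneg
    linarith
  -- Then 2r < δ, which makes the invariant balls disjoint by `invDist_le_of_invDist_le`, and r < 1.
  set r : ℝ := min (δ / 4) (1 / 2) with hr
  have hr0 : 0 < r := by positivity
  have hr1 : r < 1 := (min_le_right _ _).trans_lt (by norm_num)
  have hrδ : 2 * r < δ := by linarith [min_le_left (δ / 4) (1 / 2 : ℝ)]
  have hI := bergmanNorm_one_lt_top hn hα
  set I := bergmanNorm α (fun _ : Cn n => (1 : ℂ)) with hIdef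
  have hI' : I = ∫⁻ w in ball (0 : Cn n) 1, ENNReal.ofReal ((1 - ‖w‖ ^ 2) ^ α) := by
    simp [hIdef, bergmanNorm]
  set A := ENNReal.ofReal (4⁻¹ ^ ((n : ℝ) + 1 + α)) *
    ∫⁻ u in ball (0 : Cn n) r, ENNReal.ofReal ((1 - ‖u‖ ^ 2) ^ α) with hA
  have hA0 : A ≠ 0 := by
    refine mul_ne_zero (by simpa using by positivity) (ne_of_gt ?_)
    rw [setLIntegral_pos_iff (measurable_weight α), Set.inter_eq_self_of_subset_right]
    · exact measure_ball_pos _ _ hr0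
    · intro u hu
      have := one_sub_sq_norm_pos ((mem_ball_zero_iff.1 hu).trans hr1)
      simpa using by positivity
  have hAI : A ≠ ∞ := by
    refine ENNReal.mul_ne_top ENNReal.ofReal_ne_top (ne_of_lt (lt_of_le_of_lt ?_ hI))
    rw [hI']
    exact lintegral_mono_set (ball_subset_ball hr1.le)
  refine ⟨(I / A).toReal, ENNReal.toReal_nonneg, fun {κ} c hc hsep F => ?_⟩
  have hpw : Pairwise (Function.onFun Disjoint fun k => ballInvolution (c k) '' ball 0 r) := by
    intro j k hjk
    refine Set.disjoint_left.2 ?_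
    rintro w ⟨u, hu, rfl⟩ ⟨v, hv, hvu⟩
    rw [mem_ball_zero_iff] at hu hv
    have hw := norm_ballInvolution_lt (hc j) (hu.trans hr1)
    have e1 : invDist (ballInvolution (c j) u) (c j) ≤ r := by
      rw [invDist_comm hw (hc j), invDist, ballInvolution_ballInvolution (hc j) (hu.trans hr1)]
      exact hu.le
    have e2 : invDist (ballInvolution (c j) u) (c k) ≤ r := by
      rw [invDist_comm hw (hc k), ← hvu, invDist,
        ballInvolution_ballInvolution (hc k) (hv.trans hr1)]
      exact hv.le
    have := invDist_le_of_invDist_le hr1 hw (hc j) (hc k) e1 e2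
    linarith [hsep j k hjk]
  have hsum : (∑ k ∈ F, ENNReal.ofReal ((1 - ‖c k‖ ^ 2) ^ ((n : ℝ) + 1 + α))) * A ≤ I := by
    rw [Finset.sum_mul]
    refine (Finset.sum_le_sum fun k _ =>
      mul_lintegral_le_lintegral_image ht (hc k) hr1.le).trans ?_
    rw [← lintegral_biUnion_finset (fun j _ k _ hjk => hpw hjk) fun k _ =>
      measurableSet_image_ballInvolution (hc k) measurableSet_ball (ball_subset_ball hr1.le), hI']
    refine lintegral_mono_set (Set.iUnion₂_subset fun k _ => ?_)
    rw [← image_ballInvolution (hc k)]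
    exact Set.image_mono (ball_subset_ball hr1.le)
  have h2 := (ENNReal.le_div_iff_mul_le (Or.inl hA0) (Or.inl hAI)).2 hsum
  have hpos : ∀ k ∈ F, 0 ≤ (1 - ‖c k‖ ^ 2) ^ ((n : ℝ) + 1 + α) := fun k _ =>
    Real.rpow_nonneg (one_sub_sq_norm_pos (hc k)).le _
  rw [← ENNReal.ofReal_sum_of_nonneg hpos] at h2
  exact (ENNReal.ofReal_le_iff_le_toReal (ENNReal.div_ne_top hI.ne hA0)).1 h2

/-- For a separated sequence the sums `∑ (1 - d(z, b_k)²)^{n+1+α}` are bounded uniformly in `z`. -/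
theorem IsSeparatedSeq.exists_sum_le (hn : 1 ≤ n) {α : ℝ} (hα : -1 < α) {κ : Type*}
    {b : κ → Cn n} (hb : ∀ k, ‖b k‖ < 1) (hsep : IsSeparatedSeq b) :
    ∃ C : ℝ, 0 ≤ C ∧ ∀ z : Cn n, ‖z‖ < 1 → ∀ F : Finset κ,
      ∑ k ∈ F, (1 - invDist (b k) z ^ 2) ^ ((n : ℝ) + 1 + α) ≤ C := by
  obtain ⟨δ, hδ, h⟩ := hsep
  obtain ⟨C, hC, hsum⟩ := exists_sum_rpow_le hn hα hδ
  refine ⟨C, hC, fun z hz F => ?_⟩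
  -- The family φ_z(b_k) has the same separation constant, and 1 - |φ_z(b_k)|² is 1 - d(z, b_k)².
  have := hsum (fun k => ballInvolution z (b k)) (fun k => norm_ballInvolution_lt hz (hb k))
    (fun j k hjk => by rw [invDist_ballInvolution hz (hb j) (hb k)]; exact h j k hjk) F
  refine le_trans (le_of_eq (Finset.sum_congr rfl fun k _ => ?_)) this
  rw [invDist_comm (hb k) hz, invDist]

/-! ### Splitting a kernel with bounded row sums by colouring. -/

/-- Take a colouring that minimises the total monochromatic energy E. The row of k, split by colour,
has total at most S, so some colour m receives at most S / M. Recolouring k by m changes E only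
through twice the row sum at k, and minimality then bounds the row sum for the original colour. -/
theorem exists_coloring_sum_le_of_fintype {ι : Type*} [Fintype ι] [DecidableEq ι]
    (K : ι → ι → ℝ) (hsymm : ∀ j k, K j k = K k j) (hdiag : ∀ k, K k k = 0) {S : ℝ}
    (hS : ∀ k, ∑ j, K j k ≤ S) {M : ℕ} (hM : 0 < M) :
    ∃ c : ι → Fin M, ∀ k, ∑ j, (if c j = c k then K j k else 0) ≤ S / M := by
  have : Nonempty (Fin M) := ⟨⟨0, hM⟩⟩
  let E : (ι → Fin M) → ℝ := fun c => ∑ j, ∑ k, if c j = c k then K j k else 0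
  obtain ⟨c, hc⟩ := Finite.exists_min E
  refine ⟨c, fun k => ?_⟩
  have hsplit : ∀ e : ι → Fin M, E e = 2 * (∑ j, if e j = e k then K j k else 0) +
      ∑ j ∈ Finset.univ.erase k, ∑ l ∈ Finset.univ.erase k,
        if e j = e l then K j l else 0 := by
    intro e
    have h1 : ∑ l, (if e k = e l then K k l else 0) = ∑ j, if e j = e k then K j k else 0 :=
      Finset.sum_congr rfl fun j _ => by rw [hsymm k j]; simp only [eq_comm]
    have h2 : ∑ j ∈ Finset.univ.erase k, (if e j = e k then K j k else 0) =
        ∑ j, if e j = e k then K j k else 0 := by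
      rw [← Finset.add_sum_erase _ _ (Finset.mem_univ k)]
      simp [hdiag]
    change ∑ j, ∑ l, (if e j = e l then K j l else 0) = _
    rw [← Finset.add_sum_erase _ _ (Finset.mem_univ k), h1]
    rw [Finset.sum_congr rfl fun j _ => (Finset.add_sum_erase Finset.univ
      (fun l => if e j = e l then K j l else 0) (Finset.mem_univ k)).symm,
      Finset.sum_add_distrib, h2]
    ring
  obtain ⟨m, -, hm⟩ : ∃ m ∈ (Finset.univ : Finset (Fin M)),
      ∑ j, (if c j = m then K j k else 0) ≤ S / M := by
    refine Finset.exists_le_of_sum_le Finset.univ_nonempty ?_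
    rw [Finset.sum_comm, Finset.sum_const, Finset.card_univ, Fintype.card_fin, nsmul_eq_mul,
      mul_div_cancel₀ _ (by exact_mod_cast hM.ne')]
    simpa using hS k
  have hle := hc (Function.update c k m)
  rw [hsplit, hsplit] at hle
  have hR : ∑ j ∈ Finset.univ.erase k, ∑ l ∈ Finset.univ.erase k,
        (if Function.update c k m j = Function.update c k m l then K j l else 0) =
      ∑ j ∈ Finset.univ.erase k, ∑ l ∈ Finset.univ.erase k, if c j = c l then K j l else 0 := by
    refine Finset.sum_congr rfl fun j hj => Finset.sum_congr rfl fun l hl => ?_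
    rw [Function.update_of_ne (Finset.ne_of_mem_erase hj),
      Function.update_of_ne (Finset.ne_of_mem_erase hl)]
  have hs : ∑ j, (if Function.update c k m j = Function.update c k m k then K j k else 0) =
      ∑ j, if c j = m then K j k else 0 := by
    refine Finset.sum_congr rfl fun j _ => ?_
    rcases eq_or_ne j k with rfl | hjk
    · simp [hdiag]
    · rw [Function.update_of_ne hjk, Function.update_self]
  rw [hR, hs] at hle
  linarith

/-- A symmetric kernel with nonnegative entries and row sums bounded by `S` admits a colouring with
`M` colours for which the row sums within each colour are bounded by `S / M`. -/
theorem exists_coloring_sum_le {ι : Type*} (K : ι → ι → ℝ) (hsymm : ∀ j k, K j k = K k j)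
    (hdiag : ∀ k, K k k = 0) (hK : ∀ j k, 0 ≤ K j k) {S : ℝ}
    (hS : ∀ k, ∀ F : Finset ι, ∑ j ∈ F, K j k ≤ S) {M : ℕ} (hM : 0 < M) :
    ∃ c : ι → Fin M, ∀ k, ∀ F : Finset ι, ∑ j ∈ F, (if c j = c k then K j k else 0) ≤ S / M := by
  classical
  have : Nonempty (Fin M) := ⟨⟨0, hM⟩⟩
  -- Passage to infinite ι by compactness of the space of colourings: the sets `A F` are closed,
  -- nonempty by the finite case, and decreasing in F because the entries are nonnegative.
  let A : Finset ι → Set (ι → Fin M) := fun F =>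
    {c | ∀ k ∈ F, ∑ j ∈ F, (if c j = c k then K j k else 0) ≤ S / M}
  have hclosed : ∀ F, IsClosed (A F) := fun F => by
    have : A F = ⋂ k ∈ F, {c | ∑ j ∈ F, (if c j = c k then K j k else 0) ≤ S / M} := by
      ext c
      simp [A]
    rw [this]
    refine isClosed_biInter fun k _ => isClosed_le ?_ continuous_const
    refine continuous_finsetSum _ fun j _ => ?_
    have h1 : Continuous fun p : Fin M × Fin M => if p.1 = p.2 then K j k else 0 :=
      continuous_of_discreteTopology
    have h2 : Continuous fun c : ι → Fin M => (c j, c k) := by fun_prop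
    exact h1.comp h2
  have hmono : ∀ F G : Finset ι, F ⊆ G → A G ⊆ A F := fun F G hFG c hc k hk =>
    (Finset.sum_le_sum_of_subset_of_nonneg hFG fun j _ _ => by
      split_ifs
      · exact hK j k
      · exact le_rfl).trans (hc k (hFG hk))
  have hne : ∀ F, (A F).Nonempty := fun F => by
    obtain ⟨c, hc⟩ := exists_coloring_sum_le_of_fintype (ι := F) (fun j k => K j k)
      (fun j k => hsymm j k) (fun k => hdiag k) (S := S)
      (fun k => by
        rw [Finset.sum_coe_sort F (fun j => K j k)]
        exact hS k F) hM
    refine ⟨fun j => if h : j ∈ F then c ⟨j, h⟩ else Classical.arbitrary _, fun k hk => ?_⟩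
    refine le_trans (le_of_eq ?_) (hc ⟨k, hk⟩)
    rw [← Finset.sum_coe_sort F]
    refine Finset.sum_congr rfl fun j _ => ?_
    simp [hk]
  obtain ⟨c, hc⟩ := IsCompact.nonempty_iInter_of_directed_nonempty_isCompact_isClosed A
    (fun F G => ⟨F ∪ G, hmono _ _ Finset.subset_union_left, hmono _ _ Finset.subset_union_right⟩)
    hne (fun F => (hclosed F).isCompact) hclosed
  refine ⟨c, fun k F => ?_⟩
  have h := Set.mem_iInter.1 hc (insert k F) k (Finset.mem_insert_self k F)
  refine le_trans (Finset.sum_le_sum_of_subset_of_nonneg (Finset.subset_insert k F)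
    fun j _ _ => ?_) h
  split_ifs
  · exact hK j k
  · exact le_rfl

/-! ### Operators on ℓ¹ and series of kernels. -/

theorem summable_norm_lp_one {κ : Type*} (x : lp (fun _ : κ => ℂ) 1) :
    Summable fun k => ‖x k‖ := by
  have := (memℓp_gen_iff (p := 1) (by simp)).1 (lp.memℓp x)
  simpa using this

theorem norm_lp_one {κ : Type*} (x : lp (fun _ : κ => ℂ) 1) : ‖x‖ = ∑' k, ‖x k‖ := by
  simp [lp.norm_eq_tsum_rpow (p := 1) (by simp) x]

/-- A bounded family `v` in a Banach space defines the bounded operator `x ↦ ∑ x_k v_k`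
on `ℓ¹`. -/
theorem exists_clm_lp_one {κ X : Type*} [NormedAddCommGroup X] [NormedSpace ℂ X]
    [CompleteSpace X] (v : κ → X) {B : ℝ} (hB : 0 ≤ B) (hv : ∀ k, ‖v k‖ ≤ B) :
    ∃ T : lp (fun _ : κ => ℂ) 1 →L[ℂ] X, ‖T‖ ≤ B ∧ ∀ x, HasSum (fun k => x k • v k) (T x) := by
  have hle : ∀ (x : lp (fun _ : κ => ℂ) 1) k, ‖x k • v k‖ ≤ ‖x k‖ * B := fun x k => by
    rw [norm_smul]
    exact mul_le_mul_of_nonneg_left (hv k) (norm_nonneg _)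
  have hs : ∀ x : lp (fun _ : κ => ℂ) 1, Summable fun k => x k • v k := fun x =>
    Summable.of_norm_bounded ((summable_norm_lp_one x).mul_right B) (hle x)
  let T : lp (fun _ : κ => ℂ) 1 →ₗ[ℂ] X :=
    { toFun := fun x => ∑' k, x k • v k
      map_add' := fun x y => by
        rw [← (hs x).tsum_add (hs y)]
        simp only [lp.coeFn_add, Pi.add_apply, add_smul]
      map_smul' := fun c x => by
        rw [RingHom.id_apply, ← (hs x).tsum_const_smul c]
        simp only [lp.coeFn_smul, Pi.smul_apply, smul_assoc] }
  have hT : ∀ x, ‖T x‖ ≤ B * ‖x‖ := fun x => by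
    rw [norm_lp_one, mul_comm, ← tsum_mul_right]
    exact tsum_of_norm_bounded ((summable_norm_lp_one x).mul_right B).hasSum (hle x)
  exact ⟨T.mkContinuous B hT, T.mkContinuous_norm_le hB hT, fun x => (hs x).hasSum⟩

/-- On |z| < ρ < 1 one has |1 - z ā_k| ≥ 1 - ρ for every k, so the derivatives of the terms are
dominated by a constant times |x_k|. -/
theorem differentiableOn_tsum_bergmanKernel {t : ℝ} (ht : 0 < t) {κ : Type*} {a : κ → Cn n}
    (ha : ∀ k, ‖a k‖ < 1) {x : κ → ℂ} (hx : Summable fun k => ‖x k‖) :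
    DifferentiableOn ℂ (fun z => ∑' k, x k * bergmanKernel t (a k) z) (ball 0 1) := by
  intro z hz
  obtain ⟨ρ, hzρ, hρ⟩ := exists_between (mem_ball_zero_iff.1 hz)
  have hρ0 : 0 < ρ := (norm_nonneg _).trans_lt hzρ
  have hw : ∀ k, (1 - ‖a k‖ ^ 2) ^ t ≤ 1 := fun k =>
    Real.rpow_le_one (one_sub_sq_norm_pos (ha k)).le (by nlinarith [sq_nonneg ‖a k‖]) ht.le
  have hw0 : ∀ k, 0 ≤ (1 - ‖a k‖ ^ 2) ^ t := fun k =>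
    Real.rpow_nonneg (one_sub_sq_norm_pos (ha k)).le _
  refine (hasFDerivAt_tsum_of_isPreconnected (s := ball (0 : Cn n) ρ) (x₀ := 0) (x := z)
    (f := fun k z => x k * bergmanKernel t (a k) z)
    (f' := fun k z => x k • (((((1 - ‖a k‖ ^ 2) ^ t : ℝ) : ℂ) * (((-(2 * t) : ℝ) : ℂ) *
        (1 - inner ℂ (a k) z : ℂ) ^ (((-(2 * t) : ℝ) : ℂ) - 1))) • -(innerSL ℂ (a k))))
    (u := fun k => ‖x k‖ * (2 * t * (1 - ρ) ^ (-(2 * t) - 1))) (hx.mul_right _) isOpen_ball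
    (convex_ball _ _).isPreconnected (fun k y hy => ?_) (fun k y hy => ?_)
    (mem_ball_self hρ0) ?_ (mem_ball_zero_iff.2 hzρ)).differentiableAt.differentiableWithinAt
  · exact (hasFDerivAt_bergmanKernel t (ha k)
      ((mem_ball_zero_iff.1 hy).trans hρ)).const_mul (x k)
  · have hy1 := mem_ball_zero_iff.1 hy
    rw [norm_smul]
    refine mul_le_mul_of_nonneg_left ?_ (norm_nonneg _)
    have e : ((-(2 * t) : ℝ) : ℂ) - 1 = ((-(2 * t) - 1 : ℝ) : ℂ) := by push_cast; ring
    have h1 : 1 - ρ ≤ ‖(1 - inner ℂ (a k) y : ℂ)‖ := by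
      have e1 := norm_inner_le_norm (𝕜 := ℂ) (a k) y
      have e2 := norm_sub_norm_le (1 : ℂ) (inner ℂ (a k) y)
      rw [norm_one] at e2
      nlinarith [norm_nonneg (a k), norm_nonneg y, ha k]
    rw [e, norm_smul, norm_neg, innerSL_apply_norm, norm_mul, norm_mul, Complex.norm_real,
      Complex.norm_real, Complex.norm_cpow_real, Real.norm_of_nonneg (hw0 k), norm_neg,
      Real.norm_of_nonneg (by positivity)]
    have h2 : ‖(1 - inner ℂ (a k) y : ℂ)‖ ^ (-(2 * t) - 1) ≤ (1 - ρ) ^ (-(2 * t) - 1) :=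
      Real.rpow_le_rpow_of_nonpos (by linarith) h1 (by linarith)
    calc _ ≤ 1 * (2 * t * (1 - ρ) ^ (-(2 * t) - 1)) * 1 := by
          gcongr
          · exact hw k
          · exact (ha k).le
      _ = _ := by ring
  · refine Summable.of_norm_bounded hx fun k => ?_
    rw [norm_mul]
    refine mul_le_of_le_one_right (norm_nonneg _) ?_
    simp only [bergmanKernel, inner_zero_right, sub_zero, Complex.one_cpow, mul_one,
      Complex.norm_real]
    rw [Real.norm_of_nonneg (hw0 k)]
    exact hw k

theorem bergmanNorm_bergmanKernel (α : ℝ) {a : Cn n} (ha : ‖a‖ < 1) :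
    bergmanNorm α (bergmanKernel ((n : ℝ) + 1 + α) a) = bergmanNorm α fun _ : Cn n => 1 := by
  simpa using bergmanNorm_pullback α ha fun _ => 1

/-- Every kernel has the norm of the constant 1, so Tonelli bounds the norm of the series by the ℓ¹
norm of x times that of 1. -/
theorem bergmanNorm_tsum_bergmanKernel_lt_top (hn : 1 ≤ n) {α : ℝ} (hα : -1 < α) {κ : Type*}
    [Countable κ] {a : κ → Cn n} (ha : ∀ k, ‖a k‖ < 1) {x : κ → ℂ}
    (hx : Summable fun k => ‖x k‖) :
    bergmanNorm α (fun z => ∑' k, x k * bergmanKernel ((n : ℝ) + 1 + α) (a k) z) < ∞ := by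
  set t := (n : ℝ) + 1 + α with ht
  have h1 : bergmanNorm α (fun z => ∑' k, x k * bergmanKernel t (a k) z) ≤
      ∫⁻ z in ball 0 1, ∑' k, ‖x k‖ₑ * (‖bergmanKernel t (a k) z‖ₑ *
        ENNReal.ofReal ((1 - ‖z‖ ^ 2) ^ α)) := by
    refine lintegral_mono fun z => ?_
    simp only [← mul_assoc, ENNReal.tsum_mul_right]
    gcongr
    refine (enorm_tsum_le_tsum_enorm).trans (le_of_eq ?_)
    simp only [enorm_mul]
  refine h1.trans_lt ?_
  rw [lintegral_tsum fun k => ?_]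
  · have h2 : ∀ k, ∫⁻ z in ball 0 1, ‖x k‖ₑ * (‖bergmanKernel t (a k) z‖ₑ *
        ENNReal.ofReal ((1 - ‖z‖ ^ 2) ^ α)) =
        ‖x k‖ₑ * bergmanNorm α fun _ : Cn n => 1 := fun k => by
      rw [lintegral_const_mul' _ _ enorm_ne_top, ← bergmanNorm_bergmanKernel α (ha k)]
      rfl
    simp only [h2, ENNReal.tsum_mul_right]
    refine ENNReal.mul_lt_top ?_ (bergmanNorm_one_lt_top hn hα)
    have := hx.tsum_ofReal_lt_top
    simpa only [ofReal_norm] using this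
  · exact (((differentiableOn_bergmanKernel t (ha k)).continuousOn.aemeasurable
      measurableSet_ball).enorm.mul (measurable_weight α).aemeasurable).const_mul _

/-! ### Diagonal dominance implies interpolation. -/

/-- The moduli of the entries of the weighted interpolation matrix depend only on invariant
distances; this is how the packing bound enters. -/
theorem norm_weight_mul_bergmanKernel {t : ℝ} {a b : Cn n} (ha : ‖a‖ < 1) (hb : ‖b‖ < 1) :
    ‖(((1 - ‖b‖ ^ 2) ^ t : ℝ) : ℂ) * bergmanKernel t a b‖ = (1 - invDist b a ^ 2) ^ t := by
  have h1 := one_sub_sq_norm_pos ha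
  have h2 := one_sub_sq_norm_pos hb
  have h3 := one_sub_inner_norm_pos ha hb
  rw [norm_mul, norm_bergmanKernel ha, Complex.norm_real, Real.norm_of_nonneg (by positivity),
    ← Real.mul_rpow h2.le (by positivity), one_sub_invDist_sq hb ha, norm_one_sub_inner_comm b a,
    mul_div_assoc]

theorem weight_mul_bergmanKernel_self {t : ℝ} {a : Cn n} (ha : ‖a‖ < 1) :
    (((1 - ‖a‖ ^ 2) ^ t : ℝ) : ℂ) * bergmanKernel t a a = 1 := by
  have h1 := one_sub_sq_norm_pos ha
  have h : (1 - inner ℂ a a : ℂ) = ((1 - ‖a‖ ^ 2 : ℝ) : ℂ) := by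
    rw [inner_self_eq_ofReal]
    push_cast
    rfl
  rw [bergmanKernel, h, ← Complex.ofReal_cpow h1.le, ← Complex.ofReal_mul, ← Complex.ofReal_mul,
    ← Real.rpow_add h1, ← Real.rpow_add h1]
  have : t + (t + -(2 * t)) = 0 := by ring
  rw [this, Real.rpow_zero, Complex.ofReal_one]

/-- A sequence whose invariant kernel is strictly diagonally dominant is interpolating. -/
theorem isInterpolatingSeq_of_sum_le (hn : 1 ≤ n) {α : ℝ} (hα : -1 < α) {κ : Type*}
    [Countable κ] {a : κ → Cn n} (ha : ∀ k, ‖a k‖ < 1)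
    (h : ∀ k, ∀ F : Finset κ, k ∉ F →
      ∑ j ∈ F, (1 - invDist (a j) (a k) ^ 2) ^ ((n : ℝ) + 1 + α) ≤ 1 / 2) :
    IsInterpolatingSeq 1 α a := by
  classical
  set t := (n : ℝ) + 1 + α with ht
  have ht0 : 0 < t := by
    have : (0 : ℝ) ≤ n := n.cast_nonneg
    linarith
  set w : κ → ℝ := fun k => (1 - ‖a k‖ ^ 2) ^ t with hw
  have hw0 : ∀ k, (w k : ℂ) ≠ 0 := fun k => by
    exact_mod_cast (Real.rpow_pos_of_pos (one_sub_sq_norm_pos (ha k)) _).ne'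
  -- The k-th column of the interpolation matrix without its diagonal, which consists of ones. On ℓ¹
  -- the operator norm is controlled by the ℓ¹ norms of the columns.
  let col : κ → κ → ℂ := fun k j => if j = k then 0 else (w j : ℂ) * bergmanKernel t (a k) (a j)
  have hcolsum : ∀ k, ∀ F : Finset κ, ∑ j ∈ F, ‖col k j‖ ≤ 1 / 2 := fun k F => by
    rw [← Finset.sum_erase F (a := k) (by simp [col])]
    refine le_trans (le_of_eq (Finset.sum_congr rfl fun j hj => ?_))
      (h k (F.erase k) (Finset.notMem_erase k F))
    simp only [col, if_neg (Finset.ne_of_mem_erase hj)]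
    exact norm_weight_mul_bergmanKernel (ha k) (ha j)
  have hcol : ∀ k, Memℓp (col k) 1 := fun k =>
    memℓp_gen' (C := 1 / 2) fun F => by simpa using hcolsum k F
  let v : κ → lp (fun _ : κ => ℂ) 1 := fun k => ⟨col k, hcol k⟩
  have hv : ∀ k, ‖v k‖ ≤ 1 / 2 := fun k =>
    lp.norm_le_of_forall_sum_le (by simp) (by norm_num) fun F => by simpa using hcolsum k F
  obtain ⟨E, hE, hEsum⟩ := exists_clm_lp_one v (by norm_num) hv
  -- Neumann series for I + E.
  have hunit : IsUnit (1 - (-E)) := isUnit_one_sub_of_norm_lt_one (by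
    rw [norm_neg]
    exact hE.trans_lt (by norm_num))
  intro u hu
  rw [MemWeightedLp, ENNReal.toReal_one, div_one, ← ht] at hu
  let y : lp (fun _ : κ => ℂ) 1 := ⟨_, hu⟩
  obtain ⟨x, hx⟩ : ∃ x, x + E x = y := by
    obtain ⟨U, hU⟩ := hunit
    refine ⟨(↑U⁻¹ : lp (fun _ : κ => ℂ) 1 →L[ℂ] lp (fun _ : κ => ℂ) 1) y, ?_⟩
    have h1 : (1 - -E) * (↑U⁻¹ : lp (fun _ : κ => ℂ) 1 →L[ℂ] lp (fun _ : κ => ℂ) 1) = 1 := by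
      rw [← hU]
      exact U.mul_inv
    have h2 := congrArg (fun L => L y) h1
    simpa using h2
  have hxs := summable_norm_lp_one x
  refine ⟨fun z => ∑' k, x k * bergmanKernel t (a k) z, memBergman_one_iff.2
    ⟨differentiableOn_tsum_bergmanKernel ht0 ha hxs,
      bergmanNorm_tsum_bergmanKernel_lt_top hn hα ha hxs⟩, fun j => ?_⟩
  -- Coordinate j of x + E x is w_j times the value at a_j of the kernel series with coefficients x.
  have h1 : HasSum (fun k => x k * col k j) (E x j) :=
    (lp.evalCLM ℂ (fun _ : κ => ℂ) 1 j).hasSum (hEsum x)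
  have h2 : HasSum (fun k => if k = j then x j else 0) (x j) := hasSum_ite_eq j (x j)
  have h3 := (h2.add h1).mul_left ((w j : ℂ)⁻¹)
  have h4 : (w j : ℂ)⁻¹ * (x j + E x j) = u j := by
    have : x j + E x j = w j * u j := congrFun (congrArg Subtype.val hx) j
    rw [this, inv_mul_cancel_left₀ (hw0 j)]
  rw [h4] at h3
  rw [← h3.tsum_eq]
  refine tsum_congr fun k => ?_
  rcases eq_or_ne k j with rfl | hkj
  · have := weight_mul_bergmanKernel_self (t := t) (ha k)
    simp only [col, if_true, mul_zero, add_zero]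
    rw [eq_inv_mul_iff_mul_eq₀ (hw0 k), mul_left_comm, this, mul_one]
  · simp only [col, if_neg hkj, if_neg hkj.symm, zero_add]
    rw [mul_left_comm, inv_mul_cancel_left₀ (hw0 j)]

/-! ### Finite unions and the conclusion. -/

/-- Add the bounds of the pieces; overlaps only enlarge the sum of nonnegative terms. The bound for
a piece is needed at every point of the ball, since a_k need not belong to that piece. -/
theorem exists_sum_le_of_isFiniteUnionOf_isSeparatedSeq (hn : 1 ≤ n) {α : ℝ} (hα : -1 < α)
    {ι : Type*} {a : ι → Cn n} (ha : ∀ k, ‖a k‖ < 1)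
    (h : IsFiniteUnionOf (fun b => IsSeparatedSeq b) a) :
    ∃ C : ℝ, 0 ≤ C ∧ ∀ k, ∀ F : Finset ι,
      ∑ j ∈ F, (1 - invDist (a j) (a k) ^ 2) ^ ((n : ℝ) + 1 + α) ≤ C := by
  classical
  obtain ⟨N, S, hS, hsep⟩ := h
  choose C hC0 hC using fun i => IsSeparatedSeq.exists_sum_le hn hα (b := fun k : S i => a k)
    (fun k => ha k) (hsep i)
  refine ⟨∑ i, C i, Finset.sum_nonneg fun i _ => hC0 i, fun k F => ?_⟩
  set f : ι → ℝ := fun j => (1 - invDist (a j) (a k) ^ 2) ^ ((n : ℝ) + 1 + α) with hf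
  have hf0 : ∀ j, 0 ≤ f j := fun j => by
    have h1 := one_sub_sq_norm_pos (ha j)
    have h2 := one_sub_sq_norm_pos (ha k)
    have := one_sub_invDist_sq (ha j) (ha k)
    simp only [hf]
    rw [this]
    positivity
  calc ∑ j ∈ F, f j ≤ ∑ j ∈ F, ∑ i, if j ∈ S i then f j else 0 := by
        refine Finset.sum_le_sum fun j _ => ?_
        obtain ⟨i, hi⟩ := Set.mem_iUnion.1 (hS ▸ Set.mem_univ j)
        calc f j = if j ∈ S i then f j else 0 := (if_pos hi).symm
          _ ≤ _ := Finset.single_le_sum (f := fun i => if j ∈ S i then f j else 0)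
            (fun i _ => by split_ifs <;> simp [hf0]) (Finset.mem_univ i)
    _ = ∑ i, ∑ j ∈ F, if j ∈ S i then f j else 0 := Finset.sum_comm
    _ ≤ ∑ i, C i := by
        refine Finset.sum_le_sum fun i _ => ?_
        have := hC i (a k) (ha k) (F.subtype (· ∈ S i))
        rw [← Finset.sum_filter, ← Finset.sum_subtype_eq_sum_filter]
        exact this

end BallInterpolation

theorem corollary4p4 {n : ℕ} (hn : 1 ≤ n) {α : ℝ} (hα : -1 < α)
    {ι : Type*} [Countable ι] (a : ι → EuclideanSpace ℂ (Fin n))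
    (ha : ∀ k, a k ∈ Metric.ball (0 : EuclideanSpace ℂ (Fin n)) 1) :
    BallInterpolation.IsFiniteUnionOf (fun b => BallInterpolation.IsSeparatedSeq b) a ↔
      BallInterpolation.IsFiniteUnionOf
        (fun b => BallInterpolation.IsInterpolatingSeq 1 α b) a := by
  open BallInterpolation in
  classical
  have ha' : ∀ k, ‖a k‖ < 1 := fun k => mem_ball_zero_iff.1 (ha k)
  constructor
  · intro h
    obtain ⟨C, hC0, hC⟩ := exists_sum_le_of_isFiniteUnionOf_isSeparatedSeq hn hα ha' h
    -- This makes C / M at most 1/2, the dominance threshold.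
    obtain ⟨M, hM⟩ := exists_nat_gt (2 * C)
    have hM0 : (0 : ℝ) < M := by linarith
    set K : ι → ι → ℝ := fun j k => (1 - invDist (a j) (a k) ^ 2) ^ ((n : ℝ) + 1 + α) with hK
    have hK0 : ∀ j k, 0 ≤ K j k := fun j k => by
      have h1 := one_sub_sq_norm_pos (ha' j)
      have h2 := one_sub_sq_norm_pos (ha' k)
      have := one_sub_invDist_sq (ha' j) (ha' k)
      simp only [hK]
      rw [this]
      positivity
    -- The diagonal entries of K equal 1 and are replaced by 0, since no colouring can reduce them.
    obtain ⟨c, hc⟩ := exists_coloring_sum_le (fun j k => if j = k then 0 else K j k)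
      (fun j k => by
        rcases eq_or_ne j k with rfl | hjk
        · rfl
        · simp only [if_neg hjk, if_neg hjk.symm, hK]
          rw [invDist_comm (ha' j) (ha' k)])
      (fun k => if_pos rfl)
      (fun j k => by split_ifs <;> simp [hK0])
      (fun k F => by
        refine le_trans (Finset.sum_le_sum (g := fun j => K j k) fun j _ => ?_) (hC k F)
        split_ifs <;> simp [hK0])
      (Nat.cast_pos.1 hM0)
    refine ⟨M, fun i => {k | c k = i}, Set.eq_univ_of_forall fun k =>
      Set.mem_iUnion.2 ⟨c k, rfl⟩, fun i => ?_⟩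
    refine isInterpolatingSeq_of_sum_le hn hα (fun k => ha' k) fun k F hkF => ?_
    have hle := hc k (F.map (Function.Embedding.subtype _))
    rw [Finset.sum_map] at hle
    refine (le_trans (le_of_eq (Finset.sum_congr rfl fun j hj => ?_)) hle).trans ?_
    · have h1 : (j : ι) ≠ k := fun e => hkF (Subtype.ext e ▸ hj)
      have h2 : c j = c k := j.2.trans k.2.symm
      simp [h1, h2, hK]
    · rw [div_le_iff₀ hM0]
      linarith
  · rintro ⟨N, S, hS, hint⟩
    exact ⟨N, S, hS, fun i => (hint i).isSeparatedSeq fun k => ha' k⟩
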